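/- Let $\Gamma$ be a totally ordered abelian group with positive cone $\Gamma^+=\{x\in\Gamma: 0\le x\}$, let $\mathcal A$ be a $C^*$-algebra with identity $1$, and let $\alpha:\Gamma^+\to\mathrm{End}(\mathcal A)$ be an action by (not necessarily unital) $*$-endomorphisms: $\alpha_0=\mathrm{Id}$ and $\alpha_{x+y}=\alpha_x\circ\alpha_y$ for $x,y\in\Gamma^+$. The system $(\mathcal A,\Gamma^+,\alpha)$ is called *finely representable* if there are a Hilbert space $H$, a faithful non-degenerate $*$-representation $\pi:\mathcal A\to L(H)$ and a map $U:\Gamma^+\to L(H)$ with $U_{x+y}=U_xU_y$ such that, for all $a\in\mathcal A$ and $x\in\Gamma^+$, $$\pi(\alpha_x(a))=U_x\pi(a)U_x^*,\qquad U_x^*\pi(a)U_x\in\pi(\mathcal A),\qquad U_x\pi(a)=\pi(\alpha_x(a))U_x .$$ A *transfer action* for $(\mathcal A,\Gamma^+,\alpha)$ is a family $L=(L_x)_{x\in\Gamma^+}$ of continuous linear positive maps $L_x:\mathcal A\to\mathcal A$ with $L_{x+y}=L_y\circ L_x$ and $L_x(\alpha_x(a)b)=aL_x(b)$ for all $x,y\in\Gamma^+$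 and $a,b\in\mathcal A$. It is *non-degenerate* if $\alpha_x\circ L_x\circ\alpha_x=\alpha_x$ for all $x\in\Gamma^+$, and *complete* if $\alpha_x(L_x(a))=\alpha_x(1)\,a\,\alpha_x(1)$ for all $x\in\Gamma^+$ and $a\in\mathcal A$. **Theorem 3.2.** The system $(\mathcal A,\Gamma^+,\alpha)$ is finely representable if and only if there exists a complete transfer action for it. Moreover, these two conditions are equivalent to each of the following: - there exists a non-degenerate transfer action for $(\mathcal A,\Gamma^+,\alpha)$, and $\alpha_x(\mathcal A)$ is a hereditary subalgebra of $\mathcal A$ for each $x\in\Gamma^+$ (that is, $0\le a\le b$ with $a\in\mathcal A$ and $b\in\alpha_x(\mathcal A)$ implies $a\in\alpha_x(\mathcal A)$); - there exists a family $(P_x)_{x\in\Gamma^+}$ of central orthogonal projections in $\mathcal A$ such that $\alpha_x(P_{x+y})=\alpha_x(1)P_y$ for all $x,y\in\Gamma^+$ and $\alpha_x:P_x\mathcal A\to\alpha_x(\mathcal A)$ is a $*$-isomorphism for each $x\in\Gamma^+$; and $\alpha_x(\mathcal A)=\alpha_x(1)\mathcal A\alpha_x(1)$ for each $x\in\Gamma^+$.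 -/

import Mathlib

/-- The positive cone `Γ⁺ = {x ∈ Γ : 0 ≤ x}` of an ordered abelian group; it carries Mathlib's
additive commutative monoid structure on `{x : Γ // 0 ≤ x}`. -/
abbrev PosCone (Γ : Type*) [AddCommGroup Γ] [LinearOrder Γ] [IsOrderedAddMonoid Γ] : Type _ :=
  {x : Γ // 0 ≤ x}

/-- A C⋆-dynamical system `(A, Γ⁺, α)`: an action of the positive cone `Γ⁺` on `A` by
`*`-endomorphisms, which need not preserve the identity of `A`. -/
structure EndoAction (Γ : Type*) [AddCommGroup Γ] [LinearOrder Γ] [IsOrderedAddMonoid Γ]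
    (A : Type*) [CStarAlgebra A] where
  /-- the endomorphism `α_x` -/
  endo : PosCone Γ → (A →⋆ₙₐ[ℂ] A)
  endo_zero : endo 0 = NonUnitalStarAlgHom.id ℂ A
  endo_add : ∀ x y : PosCone Γ, endo (x + y) = (endo x).comp (endo y)

/-- `L` is a transfer action for `(A, Γ⁺, α)`: an action of `Γ⁺` by continuous, linear, positive
maps such that `L_x(α_x(a) b) = a L_x(b)`. -/
structure IsTransferAction {Γ : Type*} [AddCommGroup Γ] [LinearOrder Γ] [IsOrderedAddMonoid Γ]
    {A : Type*} [CStarAlgebra A] [PartialOrder A] [StarOrderedRing A]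
    (α : EndoAction Γ A) (L : PosCone Γ → (A →L[ℂ] A)) : Prop where
  positive : ∀ (x : PosCone Γ) (a : A), 0 ≤ a → 0 ≤ L x a
  map_add : ∀ x y : PosCone Γ, L (x + y) = (L y).comp (L x)
  transfer : ∀ (x : PosCone Γ) (a b : A), L x (α.endo x a * b) = a * L x b

/-- A transfer action is non-degenerate if `α_x ∘ L_x ∘ α_x = α_x` for all `x ∈ Γ⁺`. -/
structure IsNondegenerateTransferAction {Γ : Type*} [AddCommGroup Γ] [LinearOrder Γ]
    [IsOrderedAddMonoid Γ] {A : Type*} [CStarAlgebra A] [PartialOrder A] [StarOrderedRing A]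
    (α : EndoAction Γ A) (L : PosCone Γ → (A →L[ℂ] A)) : Prop
    extends IsTransferAction α L where
  nondegenerate : ∀ (x : PosCone Γ) (a : A), α.endo x (L x (α.endo x a)) = α.endo x a

/-- A transfer action is complete if `α_x(L_x(a)) = α_x(1) a α_x(1)`. -/
structure IsCompleteTransferAction {Γ : Type*} [AddCommGroup Γ] [LinearOrder Γ]
    [IsOrderedAddMonoid Γ] {A : Type*} [CStarAlgebra A] [PartialOrder A] [StarOrderedRing A]
    (α : EndoAction Γ A) (L : PosCone Γ → (A →L[ℂ] A)) : Prop
    extends IsTransferAction α L where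
  complete : ∀ (x : PosCone Γ) (a : A), α.endo x (L x a) = α.endo x 1 * a * α.endo x 1

/-- A subset `B` of `A` (in the use below, the range of a `*`-endomorphism, which is a
C⋆-subalgebra) is hereditary: `0 ≤ a ≤ b` and `b ∈ B` imply `a ∈ B`. -/
def IsHereditarySubset {A : Type*} [CStarAlgebra A] [PartialOrder A] [StarOrderedRing A]
    (B : Set A) : Prop :=
  ∀ a b : A, 0 ≤ a → a ≤ b → b ∈ B → a ∈ B

/-- `P` is a family of central orthogonal projections of `A` such that
`α_x(P_{x+y}) = α_x(1) P_y` and `α_x` restricts to a `*`-isomorphism of `P_x A` onto `α_x(A)`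
(as `α_x` is a `*`-homomorphism, this means that the restriction is bijective). -/
structure IsCentralProjectionFamily {Γ : Type*} [AddCommGroup Γ] [LinearOrder Γ]
    [IsOrderedAddMonoid Γ] {A : Type*} [CStarAlgebra A]
    (α : EndoAction Γ A) (P : PosCone Γ → A) : Prop where
  isStarProjection : ∀ x, IsStarProjection (P x)
  central : ∀ (x : PosCone Γ) (a : A), P x * a = a * P x
  endo_apply : ∀ x y : PosCone Γ, α.endo x (P (x + y)) = α.endo x 1 * P y
  bijOn : ∀ x : PosCone Γ,
    Set.BijOn (α.endo x) (Set.range fun a : A => P x * a) (Set.range (α.endo x))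

/-- `(H, π, U)` is a fine representation of `(A, Γ⁺, α)`: `π` is a faithful non-degenerate
representation of `A` on `H`, `U` is a semigroup homomorphism from `Γ⁺` to the bounded operators
on `H`, and the relations between `π`, `U` and `α` hold. -/
structure IsFineRepresentation {Γ : Type*} [AddCommGroup Γ] [LinearOrder Γ]
    [IsOrderedAddMonoid Γ] {A : Type*} [CStarAlgebra A] (α : EndoAction Γ A)
    {H : Type*} [NormedAddCommGroup H] [InnerProductSpace ℂ H] [CompleteSpace H]
    (π : A →⋆ₙₐ[ℂ] (H →L[ℂ] H)) (U : PosCone Γ → (H →L[ℂ] H)) : Prop where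
  faithful : Function.Injective π
  nondegenerate :
    (Submodule.span ℂ {h : H | ∃ (a : A) (k : H), π a k = h}).topologicalClosure = ⊤
  map_add : ∀ x y : PosCone Γ, U (x + y) = U x * U y
  endo_eq : ∀ (x : PosCone Γ) (a : A), π (α.endo x a) = U x * π a * star (U x)
  star_conj_mem : ∀ (x : PosCone Γ) (a : A), star (U x) * π a * U x ∈ Set.range π
  intertwine : ∀ (x : PosCone Γ) (a : A), U x * π a = π (α.endo x a) * U x

universe u v w

/-- `(A, Γ⁺, α)` is finely representable (on a Hilbert space in the universe `w`). -/
def FinelyRepresentable {Γ : Type v} [AddCommGroup Γ] [LinearOrder Γ] [IsOrderedAddMonoid Γ]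
    {A : Type u} [CStarAlgebra A] (α : EndoAction Γ A) : Prop :=
  ∃ (H : Type w) (_ : NormedAddCommGroup H) (_ : InnerProductSpace ℂ H) (_ : CompleteSpace H)
    (π : A →⋆ₙₐ[ℂ] (H →L[ℂ] H)) (U : PosCone Γ → (H →L[ℂ] H)), IsFineRepresentation α π U

/-! Complete transfer actions are the hub: each other condition is shown equivalent to their
existence. With `e = α_x(1)`, completeness says that `α_x ∘ L_x` is compression to the corner `eAe`,
so `α_x(A) = eAe`.

A fine representation gives `L_x(a) = π⁻¹(U_x* π(a) U_x)`, and `π(e) = U_x U_x*` makes it complete.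
Corners are hereditary (`eq_mul_mul_of_nonneg_of_le`); conversely, heredity puts `ebe ≤ ‖b‖e` in the
range of `α_x`, where non-degeneracy computes `α_x ∘ L_x`. A complete `L` gives the central
projections `P_x = L_x(1)`; conversely, `L_x(a)` is the unique element of `P_x A` that `α_x` sends
to `eae`.

The substantial direction builds a representation from a complete `L`. For `g : Γ` with positive and
negative parts `p`, `m`, and a positive functional `f`, a copy of `A` carries the form `f (L_p (a*
α_m(1) b))`. On level `g`, `a` acts as left multiplication by `α_m(a)`. The operator `U_x` moves
level `g` to `g + x`, cutting by `α_m(1)` and applying `α_t`, where `t = climb x g` is the part of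
the move above zero; its adjoint is `L_t`. The negative levels make `U_x π(a) U_x* = π(α_x(a))`
hold, since every level is the target of a shift. Completing the orthogonal sum gives the Hilbert
space; level zero, with enough functionals, gives faithfulness. -/

/-! ### Positivity in C⋆-algebras and existence of positive functionals. -/

section CStarLemmas

variable {A : Type*} [CStarAlgebra A] [PartialOrder A] [StarOrderedRing A]

/-- An injective `*`-homomorphism between C⋆-algebras reflects positivity. -/
theorem NonUnitalStarAlgHom.nonneg_of_map_nonneg {B : Type*} [CStarAlgebra B] [PartialOrder B]
    [StarOrderedRing B] (φ : A →⋆ₙₐ[ℂ] B) (hφ : Function.Injective φ) {a : A} (ha : 0 ≤ φ a) :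
    0 ≤ a := by
  have hsa : IsSelfAdjoint a := by
    apply hφ
    rw [map_star]
    exact (IsSelfAdjoint.of_nonneg ha).star_eq
  have hcont : Continuous φ := (NonUnitalStarAlgHom.isometry φ hφ).continuous
  -- Continuous functional calculus commutes with `φ`, so injectivity kills the negative part of
  -- `a`.
  have h1 : φ (a⁻) = (φ a)⁻ := by
    rw [CFC.negPart_def, CFC.negPart_def]
    exact NonUnitalStarAlgHomClass.map_cfcₙ φ (fun x : ℝ => x⁻) a (by fun_prop) (by simp) hcont hsa
      (hsa.map φ)
  have h2 : a⁻ = 0 := by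
    apply hφ
    rw [h1, map_zero]
    exact (CFC.negPart_eq_zero_iff _ (hsa.map φ)).mpr ha
  exact (CFC.negPart_eq_zero_iff _ hsa).mp h2

/-- A positive element dominated by a positive element of the corner `eAe` lies in `eAe`. -/
theorem eq_mul_mul_of_nonneg_of_le {e a b : A} (he : IsStarProjection e) (ha : 0 ≤ a)
    (hab : a ≤ b) (hb : b = e * b * e) : a = e * a * e := by
  have hf : star (1 - e) = 1 - e := by rw [star_sub, star_one, he.isSelfAdjoint.star_eq]
  have hee : e * e = e := he.isIdempotentElem
  have hfb : (1 - e) * b * (1 - e) = 0 := by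
    rw [hb]
    have : (1 - e) * e = 0 := by rw [sub_mul, one_mul, hee, sub_self]
    rw [← mul_assoc, ← mul_assoc, this]
    simp
  have hle : (1 - e) * a * (1 - e) ≤ 0 := by
    have := star_left_conjugate_le_conjugate hab (1 - e)
    rwa [hf, hfb] at this
  have hge : 0 ≤ (1 - e) * a * (1 - e) := by
    have := star_left_conjugate_nonneg ha (1 - e)
    rwa [hf] at this
  have hz : (1 - e) * a * (1 - e) = 0 := le_antisymm hle hge
  obtain ⟨c, rfl⟩ := CStarAlgebra.nonneg_iff_eq_star_mul_self.mp ha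
  -- With `a = c* c`, the vanishing compression is `(c(1-e))* (c(1-e))`.
  have hc : c * (1 - e) = 0 := by
    rw [← CStarRing.star_mul_self_eq_zero_iff, star_mul, hf, ← hz]
    simp only [mul_assoc]
  have hc' : c * e = c := by
    rw [mul_sub, mul_one, sub_eq_zero] at hc
    exact hc.symm
  have hc'' : e * star c = star c := by
    rw [← he.isSelfAdjoint.star_eq, ← star_mul, hc']
  rw [← mul_assoc, hc'', mul_assoc, hc']

open scoped ComplexOrder in
/-- On a nonzero positive element, some positive functional does not vanish. -/
theorem exists_positiveLinearMap_ne_zero {b : A} (hb : 0 ≤ b) (hb0 : b ≠ 0) :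
    ∃ f : A →ₚ[ℂ] ℂ, f b ≠ 0 := by
  let C : ProperCone ℝ A :=
    { ConvexCone.positive ℝ A |>.toPointedCone (le_refl (0 : A)) with
      isClosed' := CStarAlgebra.isClosed_nonneg }
  have hC : ∀ x, x ∈ C ↔ 0 ≤ x := fun x => Iff.rfl
  -- Hahn–Banach separates `-b` from the closed positive cone by a real functional that is
  -- nonnegative on the cone.
  have hnb : -b ∉ C := fun h => hb0 (le_antisymm (neg_nonneg.mp ((hC _).mp h)) hb)
  obtain ⟨g, hg, hgb⟩ := C.hyperplane_separation_point hnb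
  -- Precomposing with the real part makes the complexification agree with `g` on self-adjoint
  -- elements, as `i a` then has zero real part.
  let g' : Module.Dual ℝ A :=
    g.toLinearMap ∘ₗ (selfAdjoint.submodule ℝ A).subtype ∘ₗ (realPart : A →ₗ[ℝ] selfAdjoint A)
  have key : ∀ a : A, IsSelfAdjoint a → (g'.extendRCLike (𝕜 := ℂ)) a = (g a : ℂ) := by
    intro a ha
    rw [Module.Dual.extendRCLike_apply]
    have h1 : g' a = g a := by
      change g ((realPart a : selfAdjoint A) : A) = g a
      rw [ha.coe_realPart]
    have h2 : g' (Complex.I • a) = 0 := by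
      change g ((realPart (Complex.I • a) : selfAdjoint A) : A) = 0
      rw [realPart_I_smul, ha.imaginaryPart]
      simp
    simp [h1, h2]
  refine ⟨PositiveLinearMap.mk₀ (g'.extendRCLike (𝕜 := ℂ)) fun a ha => ?_, ?_⟩
  · rw [key a (.of_nonneg ha)]
    exact_mod_cast hg a ((hC a).mpr ha)
  · change (g'.extendRCLike (𝕜 := ℂ)) b ≠ 0
    rw [key b (.of_nonneg hb)]
    rw [map_neg] at hgb
    exact_mod_cast (by linarith : 0 < g b).ne'

end CStarLemmas

section Equivalences

variable {Γ : Type*} [AddCommGroup Γ] [LinearOrder Γ] [IsOrderedAddMonoid Γ]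

namespace EndoAction

variable {A : Type*} [CStarAlgebra A] (α : EndoAction Γ A)

theorem endo_add_apply (x y : PosCone Γ) (a : A) :
    α.endo (x + y) a = α.endo x (α.endo y a) := by
  rw [α.endo_add]; rfl

theorem endo_zero_apply (a : A) : α.endo 0 a = a := by
  rw [α.endo_zero]; rfl

theorem isStarProjection_endo_one (x : PosCone Γ) : IsStarProjection (α.endo x 1) :=
  (IsStarProjection.one A).map (α.endo x)

theorem endo_one_mul_endo (x : PosCone Γ) (a : A) : α.endo x 1 * α.endo x a = α.endo x a := by
  rw [← map_mul, one_mul]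

theorem endo_mul_endo_one (x : PosCone Γ) (a : A) : α.endo x a * α.endo x 1 = α.endo x a := by
  rw [← map_mul, mul_one]

theorem endo_one_mul_endo_add_one (x y : PosCone Γ) :
    α.endo x 1 * α.endo (x + y) 1 = α.endo (x + y) 1 := by
  rw [endo_add_apply, endo_one_mul_endo]

theorem endo_add_one_mul_endo_one (x y : PosCone Γ) :
    α.endo (x + y) 1 * α.endo x 1 = α.endo (x + y) 1 := by
  rw [endo_add_apply, endo_mul_endo_one]

end EndoAction

/-! ### Transfer actions, hereditary ranges and central projections. -/

section Transfer

variable {A : Type*} [CStarAlgebra A] [PartialOrder A] [StarOrderedRing A]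
  {α : EndoAction Γ A} {L : PosCone Γ → (A →L[ℂ] A)}

namespace IsTransferAction

theorem map_star (h : IsTransferAction α L) (x : PosCone Γ) (a : A) :
    L x (star a) = star (L x a) :=
  StarHomClass.map_star (PositiveLinearMap.mk₀ (L x : A →ₗ[ℂ] A) (h.positive x)) a

theorem transfer_right (h : IsTransferAction α L) (x : PosCone Γ) (a b : A) :
    L x (b * α.endo x a) = L x b * a := by
  apply star_injective
  rw [← h.map_star, star_mul, ← StarHomClass.map_star, h.transfer, h.map_star, star_mul]

theorem map_add_apply (h : IsTransferAction α L) (x y : PosCone Γ) (a : A) :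
    L (x + y) a = L y (L x a) := by
  rw [h.map_add]; rfl

theorem map_endo (h : IsTransferAction α L) (x : PosCone Γ) (a : A) :
    L x (α.endo x a) = a * L x 1 := by
  rw [← h.transfer, mul_one]

theorem map_endo_one (h : IsTransferAction α L) (x : PosCone Γ) :
    L x (α.endo x 1) = L x 1 := by
  rw [h.map_endo, one_mul]

theorem map_endo_one_mul (h : IsTransferAction α L) (x : PosCone Γ) (a : A) :
    L x (α.endo x 1 * a) = L x a := by
  rw [h.transfer, one_mul]

theorem map_mul_endo_one (h : IsTransferAction α L) (x : PosCone Γ) (a : A) :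
    L x (a * α.endo x 1) = L x a := by
  rw [h.transfer_right, mul_one]

/-- Both sides are `L_x(α_x(a))`, evaluated by the left and by the right transfer identity. -/
theorem map_one_central (h : IsTransferAction α L) (x : PosCone Γ) (a : A) :
    L x 1 * a = a * L x 1 := by
  rw [← h.transfer, ← h.transfer_right, mul_one, one_mul]

end IsTransferAction

/-- A complete transfer action is non-degenerate. -/
theorem IsCompleteTransferAction.isNondegenerate (h : IsCompleteTransferAction α L) :
    IsNondegenerateTransferAction α L where
  toIsTransferAction := h.toIsTransferAction
  nondegenerate x a := by rw [h.complete, ← map_mul, ← map_mul, one_mul, mul_one]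

/-- `L_0 = id` is not an axiom of a transfer action; it follows from completeness because `α_0 =
id`. -/
theorem IsCompleteTransferAction.map_zero (h : IsCompleteTransferAction α L) (a : A) :
    L 0 a = a := by
  have := h.complete 0 a
  simpa only [α.endo_zero_apply, one_mul, mul_one] using this

/-- The ranges of the endomorphisms are hereditary if there is a complete transfer action. -/
theorem IsCompleteTransferAction.isHereditarySubset_range (h : IsCompleteTransferAction α L)
    (x : PosCone Γ) : IsHereditarySubset (Set.range (α.endo x)) := by
  rintro a _ ha hab ⟨c, rfl⟩
  have := eq_mul_mul_of_nonneg_of_le (α.isStarProjection_endo_one x) ha hab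
    (by rw [← map_mul, ← map_mul, one_mul, mul_one])
  exact ⟨L x a, by rw [h.complete, ← this]⟩

/-- A non-degenerate transfer action is complete if the ranges of the endomorphisms are
hereditary. -/
theorem IsNondegenerateTransferAction.isComplete (h : IsNondegenerateTransferAction α L)
    (hher : ∀ x : PosCone Γ, IsHereditarySubset (Set.range (α.endo x))) :
    IsCompleteTransferAction α L where
  toIsTransferAction := h.toIsTransferAction
  complete x a := by
    have hnn : ∀ b : A, 0 ≤ b → α.endo x (L x b) = α.endo x 1 * b * α.endo x 1 := by
      intro b hb
      have he := (α.isStarProjection_endo_one x)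
      have h0 : 0 ≤ α.endo x 1 * b * α.endo x 1 := by
        have := star_left_conjugate_nonneg hb (α.endo x 1)
        rwa [he.isSelfAdjoint.star_eq] at this
      have h1 : α.endo x 1 * b * α.endo x 1 ≤ α.endo x (algebraMap ℝ A ‖b‖) := by
        have := star_left_conjugate_le_conjugate
          (IsSelfAdjoint.le_algebraMap_norm_self (IsSelfAdjoint.of_nonneg hb)) (α.endo x 1)
        rw [he.isSelfAdjoint.star_eq] at this
        refine this.trans_eq ?_
        rw [Algebra.algebraMap_eq_smul_one, mul_smul_comm, smul_mul_assoc, mul_one,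
          he.isIdempotentElem.eq, ← Complex.coe_smul, ← map_smul, Complex.coe_smul]
      obtain ⟨c, hc⟩ := hher x _ _ h0 h1 ⟨_, rfl⟩
      have h2 : L x (α.endo x 1 * b * α.endo x 1) = L x b := by
        rw [h.map_mul_endo_one, h.map_endo_one_mul]
      rw [← h2, ← hc, h.nondegenerate]
    -- Positive elements span `A`, so linearity finishes.
    obtain ⟨y, hy, -, hya⟩ := CStarAlgebra.exists_sum_four_nonneg a
    rw [hya]
    simp only [map_sum, map_smul, Finset.mul_sum, Finset.sum_mul, mul_smul_comm, smul_mul_assoc]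
    exact Finset.sum_congr rfl fun i _ => by rw [hnn _ (hy i)]

theorem IsCompleteTransferAction.range_eq (h : IsCompleteTransferAction α L) (x : PosCone Γ) :
    Set.range (α.endo x) = Set.range fun a : A => α.endo x 1 * a * α.endo x 1 := by
  ext b
  constructor
  · rintro ⟨a, rfl⟩
    exact ⟨α.endo x a, by simp only [← map_mul, one_mul, mul_one]⟩
  · rintro ⟨a, rfl⟩
    exact ⟨L x a, h.complete x a⟩

/-- The elements `L_x(1)` form a central projection family. -/
theorem IsCompleteTransferAction.isCentralProjectionFamily (h : IsCompleteTransferAction α L) :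
    IsCentralProjectionFamily α fun x => L x 1 where
  isStarProjection x :=
    { isIdempotentElem := by
        -- `L(1) L(1) = L(α(L(1))) = L(e) = L(1)`, with `e = α_x(1)`.
        change L x 1 * L x 1 = L x 1
        rw [← h.transfer, h.complete, mul_one, mul_one, h.map_mul_endo_one, h.map_endo_one]
      isSelfAdjoint := by
        change star (L x 1) = L x 1
        rw [← h.map_star, star_one] }
  central x a := h.map_one_central x a
  endo_apply x y := by
    rw [add_comm, h.map_add_apply, h.complete, mul_assoc, h.map_one_central y, ← mul_assoc,
      (α.isStarProjection_endo_one x).isIdempotentElem.eq]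
  bijOn x := by
    have hP : L x 1 * L x 1 = L x 1 := by
      rw [← h.transfer, h.complete, mul_one, mul_one, h.map_mul_endo_one, h.map_endo_one]
    refine ⟨fun _ _ => ⟨_, rfl⟩, ?_, ?_⟩
    · rintro _ ⟨a, rfl⟩ _ ⟨b, rfl⟩ hab
      -- `L_x` inverts `α_x` on `P_x A`, since `L_x(α_x(c)) = c P_x`.
      have := congrArg (L x) hab
      simp only [h.map_endo] at this
      rwa [mul_assoc, mul_assoc, ← h.map_one_central x a, ← h.map_one_central x b, ← mul_assoc,
        ← mul_assoc, hP] at this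
    · rintro _ ⟨a, rfl⟩
      refine ⟨L x 1 * a, ⟨a, rfl⟩, ?_⟩
      rw [map_mul, h.complete, mul_one, (α.isStarProjection_endo_one x).isIdempotentElem.eq,
        α.endo_one_mul_endo]

/-- A central projection family yields a complete transfer action when the ranges of the
endomorphisms are corners. -/
theorem IsCentralProjectionFamily.exists_isCompleteTransferAction {P : PosCone Γ → A}
    (hP : IsCentralProjectionFamily α P)
    (hr : ∀ x : PosCone Γ,
      Set.range (α.endo x) = Set.range fun a : A => α.endo x 1 * a * α.endo x 1) :
    ∃ L : PosCone Γ → (A →L[ℂ] A), IsCompleteTransferAction α L := by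
  have hPP : ∀ x, P x * P x = P x := fun x => (hP.isStarProjection x).isIdempotentElem
  have hex : ∀ x a, ∃ c, P x * c = c ∧ α.endo x c = α.endo x 1 * a * α.endo x 1 := by
    intro x a
    have : α.endo x 1 * a * α.endo x 1 ∈ Set.range (α.endo x) := by
      rw [hr x]; exact ⟨a, rfl⟩
    obtain ⟨_, ⟨c, rfl⟩, hc⟩ := (hP.bijOn x).surjOn this
    exact ⟨P x * c, by rw [← mul_assoc, hPP], hc⟩
  choose T hT hαT using hex
  have huniq : ∀ x c d, P x * c = c → P x * d = d → α.endo x c = α.endo x d → c = d :=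
    fun x c d hc hd h => (hP.bijOn x).injOn ⟨c, hc⟩ ⟨d, hd⟩ h
  have hpos : ∀ x a, 0 ≤ a → 0 ≤ T x a := by
    intro x a ha
    have he := α.isStarProjection_endo_one x
    have hee := he.isIdempotentElem.eq
    have h0 : 0 ≤ α.endo x 1 * a * α.endo x 1 := by
      have := star_left_conjugate_nonneg ha (α.endo x 1)
      rwa [he.isSelfAdjoint.star_eq] at this
    -- A self-adjoint square root `d` of `eae` stays in the corner, so it lifts to `T x d`, and
    -- uniqueness gives `T x a = (T x d)* (T x d)`.
    obtain ⟨d, hsa, hd⟩ := CStarAlgebra.nonneg_iff_exists_isSelfAdjoint_and_eq_mul_self.mp h0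
    have hde : d * α.endo x 1 = d := by
      have : d * (1 - α.endo x 1) = 0 := by
        rw [← CStarRing.star_mul_self_eq_zero_iff, star_mul, mul_assoc, ← mul_assoc (star d),
          hsa.star_eq, ← hd, mul_sub, mul_one, mul_assoc (_ * a) _ (α.endo x 1), hee, sub_self,
          mul_zero]
      rw [mul_sub, mul_one, sub_eq_zero] at this
      exact this.symm
    have hed : α.endo x 1 * d = d := by
      have := congrArg star hde
      rwa [star_mul, hsa.star_eq, he.isSelfAdjoint.star_eq] at this
    have hTd : α.endo x (T x d) = d := by rw [hαT, hed, hde]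
    have : T x a = star (T x d) * T x d := by
      refine huniq x _ _ (hT x a) ?_ ?_
      · rw [← mul_assoc, hP.central, mul_assoc, hT]
      · rw [hαT, map_mul, map_star, hTd, hsa.star_eq, hd]
    rw [this]
    exact star_mul_self_nonneg _
  let Tl : PosCone Γ → (A →ₗ[ℂ] A) := fun x =>
    { toFun := T x
      map_add' := fun a b => huniq x _ _ (hT x _) (by rw [mul_add, hT, hT])
        (by simp only [map_add, hαT, mul_add, add_mul])
      map_smul' := fun c a => huniq x _ _ (hT x _) (by rw [mul_smul_comm, RingHom.id_apply, hT])
        (by simp only [map_smul, hαT, mul_smul_comm, smul_mul_assoc, RingHom.id_apply]) }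
  -- Positive linear maps between C⋆-algebras are automatically continuous.
  refine ⟨fun x => ⟨Tl x, map_continuous (PositiveLinearMap.mk₀ (Tl x) (hpos x))⟩, ?_⟩
  refine { positive := hpos, map_add := ?_, transfer := ?_, complete := fun x a => hαT x a }
  · intro x y
    ext a
    change T (x + y) a = T y (T x a)
    -- Uniqueness for `x + y` needs the iterate to lie in `P_{x+y} A`; this is where `α_y(P_{y+x}) =
    -- α_y(1) P_x` enters.
    have h1 : P (x + y) * T y (T x a) = T y (T x a) := by
      apply huniq y
      · rw [← mul_assoc, hP.central y, mul_assoc, hT]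
      · exact hT y _
      · rw [map_mul, add_comm, hP.endo_apply, hαT]
        calc α.endo y 1 * P x * (α.endo y 1 * T x a * α.endo y 1)
            = α.endo y 1 * (P x * α.endo y 1) * T x a * α.endo y 1 := by simp only [mul_assoc]
          _ = (α.endo y 1 * α.endo y 1) * (P x * T x a) * α.endo y 1 := by
            rw [hP.central]; simp only [mul_assoc]
          _ = α.endo y 1 * T x a * α.endo y 1 := by
            rw [(α.isStarProjection_endo_one y).isIdempotentElem.eq, hT]
    refine huniq (x + y) _ _ (hT _ _) h1 ?_
    rw [hαT, α.endo_add_apply x y (T y (T x a)), hαT, map_mul, map_mul, hαT, ← α.endo_add_apply,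
      ← mul_assoc, ← mul_assoc, α.endo_add_one_mul_endo_one, mul_assoc (_ * a),
      α.endo_one_mul_endo_add_one]
  · intro x a b
    change T x (α.endo x a * b) = a * T x b
    refine huniq x _ _ (hT _ _) ?_ ?_
    · rw [← mul_assoc, hP.central, mul_assoc, hT]
    · rw [hαT, map_mul, hαT, ← mul_assoc, α.endo_one_mul_endo, ← mul_assoc, ← mul_assoc,
        α.endo_mul_endo_one]

end Transfer

/-! ### From a fine representation to a complete transfer action. -/

section FineRepresentation

variable {A : Type*} [CStarAlgebra A] {α : EndoAction Γ A}
  {H : Type*} [NormedAddCommGroup H] [InnerProductSpace ℂ H] [CompleteSpace H]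
  {π : A →⋆ₙₐ[ℂ] (H →L[ℂ] H)} {U : PosCone Γ → (H →L[ℂ] H)}

/-- `π 1` fixes every vector `π a k`, and these span a dense subspace. -/
theorem IsFineRepresentation.map_one (h : IsFineRepresentation α π U) : π 1 = 1 := by
  have hle : Submodule.span ℂ {h : H | ∃ (a : A) (k : H), π a k = h} ≤
      LinearMap.eqLocus (π 1 : H →ₗ[ℂ] H) LinearMap.id := by
    rw [Submodule.span_le]
    rintro _ ⟨a, k, rfl⟩
    change π 1 (π a k) = π a k
    rw [← mul_apply_eq_comp, ← map_mul, one_mul]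
  have hcl : IsClosed (LinearMap.eqLocus (π 1 : H →ₗ[ℂ] H) LinearMap.id : Set H) :=
    isClosed_eq (π 1).continuous continuous_id
  have := Submodule.topologicalClosure_minimal _ hle hcl
  rw [h.nondegenerate] at this
  ext k
  exact this (Submodule.mem_top (x := k))

/-- A fine representation induces a complete transfer action. -/
theorem IsFineRepresentation.exists_isCompleteTransferAction [PartialOrder A] [StarOrderedRing A]
    (h : IsFineRepresentation α π U) :
    ∃ L : PosCone Γ → (A →L[ℂ] A), IsCompleteTransferAction α L := by
  choose T hT using h.star_conj_mem
  have hpos : ∀ x a, 0 ≤ a → 0 ≤ T x a := by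
    intro x a ha
    obtain ⟨c, rfl⟩ := CStarAlgebra.nonneg_iff_eq_star_mul_self.mp ha
    apply NonUnitalStarAlgHom.nonneg_of_map_nonneg π h.faithful
    rw [hT, map_mul, map_star, ← mul_assoc, ← star_mul, mul_assoc]
    exact star_mul_self_nonneg _
  let Tl : PosCone Γ → (A →ₗ[ℂ] A) := fun x =>
    { toFun := T x
      map_add' := fun a b => h.faithful (by simp only [hT, _root_.map_add, mul_add, add_mul])
      map_smul' := fun c a => h.faithful
        (by simp only [hT, map_smul, mul_smul_comm, smul_mul_assoc, RingHom.id_apply]) }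
  refine ⟨fun x => ⟨Tl x, map_continuous (PositiveLinearMap.mk₀ (Tl x) (hpos x))⟩, ?_⟩
  refine { positive := hpos, map_add := ?_, transfer := ?_, complete := ?_ }
  · intro x y
    ext a
    apply h.faithful
    change π (T (x + y) a) = π (T y (T x a))
    rw [hT, hT, hT, h.map_add, star_mul]
    simp only [mul_assoc]
  · intro x a b
    apply h.faithful
    change π (T x (α.endo x a * b)) = π (a * T x b)
    have : star (U x) * π (α.endo x a) = π a * star (U x) := by
      apply star_injective
      rw [star_mul, star_star, star_mul, star_star, ← map_star, ← map_star, ← map_star,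
        h.intertwine]
    rw [hT, map_mul, map_mul, hT, ← mul_assoc, this]
    simp only [mul_assoc]
  · intro x a
    apply h.faithful
    change π (α.endo x (T x a)) = _
    have h1 : π (α.endo x 1) = U x * star (U x) := by rw [h.endo_eq, h.map_one, mul_one]
    rw [h.endo_eq, hT, map_mul, map_mul, h1]
    simp only [mul_assoc]

end FineRepresentation

end Equivalences

/-! ### Operators on the completion of a semi-inner product space. -/

section Completion

open UniformSpace

variable {E : Type*} [SeminormedAddCommGroup E] [InnerProductSpace ℂ E]

local notation "⟪" x ", " y "⟫" => inner ℂ x y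

/-- The bounded operator on the completion of a semi-inner product space induced by a bounded
linear map. -/
noncomputable def LinearMap.completionOp (T : E →ₗ[ℂ] E) (hT : ∃ C, ∀ ξ, ‖T ξ‖ ≤ C * ‖ξ‖) :
    Completion E →L[ℂ] Completion E :=
  (T.mkContinuousOfExistsBound hT).completion

theorem LinearMap.completionOp_coe (T : E →ₗ[ℂ] E) (hT : ∃ C, ∀ ξ, ‖T ξ‖ ≤ C * ‖ξ‖) (ξ : E) :
    T.completionOp hT (ξ : Completion E) = (T ξ : E) := by
  simp [LinearMap.completionOp]

/-- Elements of the completion are determined by their inner products with the original space. -/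
theorem UniformSpace.Completion.ext_inner_coe {h k : Completion E}
    (hhk : ∀ ξ : E, ⟪(ξ : Completion E), h⟫ = ⟪(ξ : Completion E), k⟫) : h = k := by
  refine ext_inner_left ℂ fun z => ?_
  induction z using Completion.induction_on with
  | hp => exact isClosed_eq (by fun_prop) (by fun_prop)
  | ih ξ => exact hhk ξ

/-- Bounded operators on the completion agreeing on the original space are equal. -/
theorem UniformSpace.Completion.clm_ext {S T : Completion E →L[ℂ] Completion E}
    (h : ∀ ξ : E, S (ξ : Completion E) = T (ξ : Completion E)) : S = T := by
  ext z
  induction z using Completion.induction_on with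
  | hp => exact isClosed_eq (by fun_prop) (by fun_prop)
  | ih ξ => exact h ξ

/-- No bound on `T` is required: the adjoint of the extended `S` already exists, and testing against
the dense image of `E` identifies it. -/
theorem LinearMap.star_completionOp_coe {S T : E →ₗ[ℂ] E} (hS : ∃ C, ∀ ξ, ‖S ξ‖ ≤ C * ‖ξ‖)
    (hadj : ∀ ξ η, ⟪S ξ, η⟫ = ⟪ξ, T η⟫) (η : E) :
    star (S.completionOp hS) (η : Completion E) = (T η : E) := by
  refine UniformSpace.Completion.ext_inner_coe fun ξ => ?_
  rw [ContinuousLinearMap.star_eq_adjoint, ContinuousLinearMap.adjoint_inner_right,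
    LinearMap.completionOp_coe, Completion.inner_coe, Completion.inner_coe, hadj]

end Completion

/-! ### Formal operators obeying the relations modulo null vectors. -/

/-- Algebraic data on a semi-inner product space whose Hilbert space completion is a fine
representation: formal operators `ρ a`, `u x` and formal adjoints `v x` of `u x`. -/
structure IsPreFineRepresentation {Γ : Type*} [AddCommGroup Γ] [LinearOrder Γ]
    [IsOrderedAddMonoid Γ] {A : Type*} [CStarAlgebra A] (α : EndoAction Γ A)
    (L : PosCone Γ → (A →L[ℂ] A))
    {E : Type*} [SeminormedAddCommGroup E] [InnerProductSpace ℂ E]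
    (ρ : A →ₗ[ℂ] (E →ₗ[ℂ] E)) (u v : PosCone Γ → (E →ₗ[ℂ] E)) : Prop where
  map_mul : ∀ a b ξ, ρ (a * b) ξ = ρ a (ρ b ξ)
  inner_map_one : ∀ ξ η, inner ℂ ξ (ρ 1 η) = inner ℂ ξ η
  inner_map_left : ∀ a ξ η, inner ℂ (ρ a ξ) η = inner ℂ ξ (ρ (star a) η)
  faithful : ∀ a, (∀ ξ η, inner ℂ ξ (ρ a η) = 0) → a = 0
  map_add : ∀ x y ξ, u (x + y) ξ = u x (u y ξ)
  inner_u_left : ∀ x ξ η, inner ℂ (u x ξ) η = inner ℂ ξ (v x η)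
  inner_conj_u : ∀ x a ξ η, inner ℂ ξ (v x (ρ a (u x η))) = inner ℂ ξ (ρ (L x a) η)
  inner_conj_v : ∀ x a ξ η, inner ℂ ξ (u x (ρ a (v x η))) = inner ℂ ξ (ρ (α.endo x a) η)
  intertwine : ∀ x a ξ, u x (ρ a ξ) = ρ (α.endo x a) (u x ξ)

namespace IsPreFineRepresentation

open UniformSpace

variable {Γ : Type*} [AddCommGroup Γ] [LinearOrder Γ]
    [IsOrderedAddMonoid Γ] {A : Type*} [CStarAlgebra A] {α : EndoAction Γ A}
    {L : PosCone Γ → (A →L[ℂ] A)}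
    {E : Type*} [SeminormedAddCommGroup E] [InnerProductSpace ℂ E]
    {ρ : A →ₗ[ℂ] (E →ₗ[ℂ] E)} {u v : PosCone Γ → (E →ₗ[ℂ] E)}

/-- Writing `‖a‖² - a* a = c* c`, the number `‖a‖² ‖ξ‖² - ‖ρ a ξ‖²` equals `‖ρ c ξ‖² ≥ 0`. -/
theorem norm_map_le (h : IsPreFineRepresentation α L ρ u v) (a : A) (ξ : E) :
    ‖ρ a ξ‖ ≤ ‖a‖ * ‖ξ‖ := by
  let _ : PartialOrder A := CStarAlgebra.spectralOrder A
  let _ : StarOrderedRing A := CStarAlgebra.spectralOrderedRing A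
  have hle : star a * a ≤ algebraMap ℝ A (‖a‖ ^ 2) := by
    rw [sq, ← CStarRing.norm_star_mul_self]
    exact IsSelfAdjoint.le_algebraMap_norm_self (IsSelfAdjoint.star_mul_self a)
  obtain ⟨c, hc⟩ := CStarAlgebra.nonneg_iff_eq_star_mul_self.mp (sub_nonneg.mpr hle)
  have key : ∀ b : A, inner ℂ (ρ b ξ) (ρ b ξ) = inner ℂ ξ (ρ (star b * b) ξ) := fun b => by
    rw [h.map_mul, h.inner_map_left]
  have h1 := key c
  rw [← hc, map_sub, LinearMap.sub_apply, inner_sub_right, ← key a,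
    Algebra.algebraMap_eq_smul_one, ← Complex.coe_smul, map_smul, LinearMap.smul_apply,
    inner_smul_right, h.inner_map_one, inner_self_eq_norm_sq_to_K, inner_self_eq_norm_sq_to_K,
    inner_self_eq_norm_sq_to_K] at h1
  have h2 : ‖ρ c ξ‖ ^ 2 = ‖a‖ ^ 2 * ‖ξ‖ ^ 2 - ‖ρ a ξ‖ ^ 2 := by
    apply Complex.ofReal_injective
    push_cast
    simpa using h1
  refine abs_le_of_sq_le_sq' ?_ (by positivity) |>.2
  nlinarith [sq_nonneg ‖ρ c ξ‖]

theorem norm_u_le (h : IsPreFineRepresentation α L ρ u v) (x : PosCone Γ) (ξ : E) :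
    ‖u x ξ‖ ≤ Real.sqrt ‖L x 1‖ * ‖ξ‖ := by
  -- Inserting `ρ 1`, invisible to the form, makes `inner_conj_u` applicable with `a = 1`.
  have h1 : inner ℂ (u x ξ) (u x ξ) = inner ℂ ξ (ρ (L x 1) ξ) := by
    rw [← h.inner_map_one, h.inner_u_left, h.inner_conj_u]
  have h2 : ‖u x ξ‖ ^ 2 ≤ ‖L x 1‖ * ‖ξ‖ ^ 2 := by
    calc ‖u x ξ‖ ^ 2 = ‖inner ℂ (u x ξ) (u x ξ)‖ := by
          rw [inner_self_eq_norm_sq_to_K]; simp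
      _ ≤ ‖ξ‖ * ‖ρ (L x 1) ξ‖ := by rw [h1]; exact norm_inner_le_norm _ _
      _ ≤ ‖ξ‖ * (‖L x 1‖ * ‖ξ‖) := by gcongr; exact h.norm_map_le _ _
      _ = ‖L x 1‖ * ‖ξ‖ ^ 2 := by ring
  refine abs_le_of_sq_le_sq' ?_ (by positivity) |>.2
  rwa [mul_pow, Real.sq_sqrt (norm_nonneg _)]

/-- The operator on the completion given by `ρ a`. -/
noncomputable def repOp (h : IsPreFineRepresentation α L ρ u v) (a : A) :
    Completion E →L[ℂ] Completion E :=
  (ρ a).completionOp ⟨‖a‖, h.norm_map_le a⟩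

theorem repOp_coe (h : IsPreFineRepresentation α L ρ u v) (a : A) (ξ : E) :
    h.repOp a (ξ : Completion E) = (ρ a ξ : E) :=
  LinearMap.completionOp_coe _ _ _

/-- The representation on the completion given by `ρ`. -/
noncomputable def rep (h : IsPreFineRepresentation α L ρ u v) :
    A →⋆ₙₐ[ℂ] (Completion E →L[ℂ] Completion E) where
  toFun := h.repOp
  map_smul' c a := Completion.clm_ext fun ξ => by simp [repOp_coe, Completion.coe_smul]
  map_zero' := Completion.clm_ext fun ξ => by simp [repOp_coe, Completion.coe_zero]
  map_add' a b := Completion.clm_ext fun ξ => by simp [repOp_coe, Completion.coe_add]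
  map_mul' a b := Completion.clm_ext fun ξ => by
    rw [mul_apply_eq_comp, h.repOp_coe, h.repOp_coe, h.repOp_coe, h.map_mul]
  map_star' a := Completion.clm_ext fun ξ => by
    rw [h.repOp_coe, repOp, LinearMap.star_completionOp_coe _ (h.inner_map_left a)]

theorem rep_coe (h : IsPreFineRepresentation α L ρ u v) (a : A) (ξ : E) :
    h.rep a (ξ : Completion E) = (ρ a ξ : E) :=
  h.repOp_coe a ξ

/-- The operator on the completion given by `u x`. -/
noncomputable def shiftOp (h : IsPreFineRepresentation α L ρ u v) (x : PosCone Γ) :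
    Completion E →L[ℂ] Completion E :=
  (u x).completionOp ⟨_, h.norm_u_le x⟩

theorem shiftOp_coe (h : IsPreFineRepresentation α L ρ u v) (x : PosCone Γ) (ξ : E) :
    h.shiftOp x (ξ : Completion E) = (u x ξ : E) :=
  LinearMap.completionOp_coe _ _ _

theorem star_shiftOp_coe (h : IsPreFineRepresentation α L ρ u v) (x : PosCone Γ) (ξ : E) :
    star (h.shiftOp x) (ξ : Completion E) = (v x ξ : E) :=
  LinearMap.star_completionOp_coe _ (h.inner_u_left x) ξ

theorem rep_one (h : IsPreFineRepresentation α L ρ u v) : h.rep 1 = 1 :=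
  Completion.clm_ext fun ξ => Completion.ext_inner_coe fun ζ => by
    rw [h.rep_coe, one_apply_eq_self, Completion.inner_coe, Completion.inner_coe, h.inner_map_one]

theorem isFineRepresentation (h : IsPreFineRepresentation α L ρ u v) :
    IsFineRepresentation α h.rep h.shiftOp where
  faithful := by
    rw [injective_iff_map_eq_zero]
    intro a ha
    refine h.faithful a fun ξ η => ?_
    rw [← Completion.inner_coe, ← h.rep_coe, ha]
    simp
  nondegenerate := by
    rw [eq_top_iff]
    refine le_trans ?_ (Submodule.le_topologicalClosure _)
    intro k _
    exact Submodule.subset_span ⟨1, k, by rw [h.rep_one]; rfl⟩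
  map_add x y := Completion.clm_ext fun ξ => by
    rw [mul_apply_eq_comp, h.shiftOp_coe, h.shiftOp_coe, h.shiftOp_coe, h.map_add]
  endo_eq x a := Completion.clm_ext fun ξ => Completion.ext_inner_coe fun ζ => by
    rw [mul_apply_eq_comp, mul_apply_eq_comp, h.star_shiftOp_coe, h.rep_coe, h.rep_coe,
      h.shiftOp_coe, Completion.inner_coe, Completion.inner_coe, h.inner_conj_v]
  star_conj_mem x a := ⟨L x a,
    Completion.clm_ext fun ξ => Completion.ext_inner_coe fun ζ => by
      rw [mul_apply_eq_comp, mul_apply_eq_comp, h.shiftOp_coe, h.rep_coe, h.rep_coe,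
        h.star_shiftOp_coe, Completion.inner_coe, Completion.inner_coe, h.inner_conj_u]⟩
  intertwine x a := Completion.clm_ext fun ξ => by
    rw [mul_apply_eq_comp, mul_apply_eq_comp, h.shiftOp_coe, h.rep_coe, h.rep_coe,
      h.shiftOp_coe, h.intertwine]

end IsPreFineRepresentation

/-! ### Orthogonal sums of positive sesquilinear forms. -/

section FinsuppForm

open scoped ComplexOrder

variable {I V : Type*} [AddCommGroup V] [Module ℂ V]

/-- The orthogonal sum of a family of sesquilinear forms. -/
noncomputable def finsuppForm (B : I → V →ₗ⋆[ℂ] V →ₗ[ℂ] ℂ) (ξ η : I →₀ V) : ℂ :=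
  η.sum fun i b => B i (ξ i) b

variable (B : I → V →ₗ⋆[ℂ] V →ₗ[ℂ] ℂ)

theorem finsuppForm_single_right (ξ : I →₀ V) (i : I) (b : V) :
    finsuppForm B ξ (Finsupp.single i b) = B i (ξ i) b :=
  Finsupp.sum_single_index (map_zero _)

theorem finsuppForm_add_left (ξ ζ η : I →₀ V) :
    finsuppForm B (ξ + ζ) η = finsuppForm B ξ η + finsuppForm B ζ η := by
  simp [finsuppForm, Finsupp.sum, Finset.sum_add_distrib]

theorem finsuppForm_smul_left (c : ℂ) (ξ η : I →₀ V) :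
    finsuppForm B (c • ξ) η = star c * finsuppForm B ξ η := by
  simp [finsuppForm, Finsupp.sum, Finset.mul_sum]

theorem finsuppForm_add_right (ξ η ζ : I →₀ V) :
    finsuppForm B ξ (η + ζ) = finsuppForm B ξ η + finsuppForm B ξ ζ :=
  Finsupp.sum_add_index' (fun _ => map_zero _) fun _ => map_add _

theorem finsuppForm_zero_right (ξ : I →₀ V) : finsuppForm B ξ 0 = 0 :=
  Finsupp.sum_zero_index

theorem finsuppForm_zero_left (η : I →₀ V) : finsuppForm B 0 η = 0 := by
  simp [finsuppForm, Finsupp.sum]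

theorem finsuppForm_star (hB : ∀ i a b, star (B i b a) = B i a b) (ξ η : I →₀ V) :
    star (finsuppForm B η ξ) = finsuppForm B ξ η := by
  classical
  induction η using Finsupp.induction_linear with
  | zero => rw [finsuppForm_zero_left, finsuppForm_zero_right, star_zero]
  | add η ζ hη hζ => rw [finsuppForm_add_left, finsuppForm_add_right, star_add, hη, hζ]
  | single i b =>
    induction ξ using Finsupp.induction_linear with
    | zero => rw [finsuppForm_zero_left, finsuppForm_zero_right, star_zero]
    | add η ζ hη hζ => rw [finsuppForm_add_left, finsuppForm_add_right, star_add, hη, hζ]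
    | single j c =>
      rw [finsuppForm_single_right, finsuppForm_single_right, Finsupp.single_apply,
        Finsupp.single_apply]
      split_ifs with h1 h2 h2
      · subst h1; exact hB _ _ _
      · exact absurd h1.symm h2
      · exact absurd h2.symm h1
      · simp

/-- The semi-inner product given by an orthogonal sum of positive hermitian forms. -/
noncomputable abbrev finsuppCore (hB : ∀ i a b, star (B i b a) = B i a b)
    (hpos : ∀ i a, 0 ≤ B i a a) : PreInnerProductSpace.Core ℂ (I →₀ V) where
  inner := finsuppForm B
  conj_inner_symm ξ η := finsuppForm_star B hB ξ η
  re_inner_nonneg ξ :=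
    (RCLike.nonneg_iff.mp (Finset.sum_nonneg fun i _ => hpos i (ξ i) : 0 ≤ finsuppForm B ξ ξ)).1
  add_left := finsuppForm_add_left B
  smul_left ξ η c := finsuppForm_smul_left B c ξ η

/-- To compare two linear operators against a form it suffices to look at single vectors. -/
theorem finsuppForm_congr_right {S T : (I →₀ V) →ₗ[ℂ] (I →₀ V)} (ξ : I →₀ V)
    (h : ∀ i b, finsuppForm B ξ (S (Finsupp.single i b)) =
      finsuppForm B ξ (T (Finsupp.single i b))) (η : I →₀ V) :
    finsuppForm B ξ (S η) = finsuppForm B ξ (T η) := by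
  induction η using Finsupp.induction_linear with
  | zero => rw [map_zero, map_zero]
  | add η ζ hη hζ => rw [map_add, map_add, finsuppForm_add_right, finsuppForm_add_right, hη, hζ]
  | single i b => exact h i b

/-- Two linear operators are adjoint to each other if they are so on single vectors. -/
theorem finsuppForm_adjoint {S T : (I →₀ V) →ₗ[ℂ] (I →₀ V)}
    (h : ∀ i a j b, finsuppForm B (S (Finsupp.single i a)) (Finsupp.single j b) =
      finsuppForm B (Finsupp.single i a) (T (Finsupp.single j b))) (ξ η : I →₀ V) :
    finsuppForm B (S ξ) η = finsuppForm B ξ (T η) := by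
  induction ξ using Finsupp.induction_linear with
  | zero => rw [map_zero, finsuppForm_zero_left, finsuppForm_zero_left]
  | add ξ ζ hξ hζ => rw [map_add, finsuppForm_add_left, finsuppForm_add_left, hξ, hζ]
  | single i a =>
    induction η using Finsupp.induction_linear with
    | zero => rw [map_zero, finsuppForm_zero_right, finsuppForm_zero_right]
    | add η ζ hη hζ => rw [map_add, finsuppForm_add_right, finsuppForm_add_right, hη, hζ]
    | single j b => exact h i a j b

end FinsuppForm

/-! ### Arithmetic of shifts across level zero. -/

namespace PosCone

variable {Γ : Type*} [AddCommGroup Γ] [LinearOrder Γ] [IsOrderedAddMonoid Γ]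

/-- The positive part of a group element. -/
def ofPos (g : Γ) : PosCone Γ := ⟨max g 0, le_max_right _ _⟩

/-- The negative part of a group element. -/
def ofNeg (g : Γ) : PosCone Γ := ofPos (-g)

/-- The part of a shift by `x` of the level `g` that takes place above zero. -/
def climb (x : PosCone Γ) (g : Γ) : PosCone Γ := ofPos (x - ofNeg g)

theorem coe_ofPos_of_nonneg {g : Γ} (hg : 0 ≤ g) : (ofPos g : Γ) = g := max_eq_left hg

theorem ofPos_of_nonpos {g : Γ} (hg : g ≤ 0) : ofPos g = 0 := Subtype.ext (max_eq_right hg)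

theorem ofNeg_of_nonneg {g : Γ} (hg : 0 ≤ g) : ofNeg g = 0 := ofPos_of_nonpos (neg_nonpos.mpr hg)

theorem coe_ofNeg_of_nonpos {g : Γ} (hg : g ≤ 0) : (ofNeg g : Γ) = -g :=
  coe_ofPos_of_nonneg (neg_nonneg.mpr hg)

theorem climb_of_nonneg (x : PosCone Γ) {g : Γ} (hg : 0 ≤ g) : climb x g = x := by
  rw [climb, ofNeg_of_nonneg hg]
  apply Subtype.ext
  rw [Nonneg.coe_zero, sub_zero, coe_ofPos_of_nonneg x.2]

theorem climb_of_nonpos (x : PosCone Γ) {g : Γ} (hg : g ≤ 0) : climb x g = ofPos (g + x) := by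
  rw [climb, coe_ofNeg_of_nonpos hg, sub_neg_eq_add, add_comm]

/-- Totality of the order leaves two regimes: the shift ends above zero, using up the negative part
and then climbing, or it ends below zero and never climbs. -/
theorem climb_cases (x : PosCone Γ) (g : Γ) :
    (x = ofNeg g + climb x g ∧ ofNeg (g + x) = 0 ∧ ofPos (g + x) = ofPos g + climb x g) ∨
    (climb x g = 0 ∧ ofNeg g = ofNeg (g + x) + x ∧ ofPos g = 0 ∧ ofPos (g + x) = 0) := by
  rcases le_total 0 g with hg | hg
  · left
    have hgx := add_nonneg hg x.2
    rw [climb_of_nonneg x hg, ofNeg_of_nonneg hg, ofNeg_of_nonneg hgx, zero_add]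
    refine ⟨rfl, rfl, Subtype.ext ?_⟩
    rw [Nonneg.coe_add, coe_ofPos_of_nonneg hg, coe_ofPos_of_nonneg hgx]
  · rw [climb_of_nonpos x hg]
    rcases le_total 0 (g + x) with hgx | hgx
    · left
      rw [ofNeg_of_nonneg hgx, ofPos_of_nonpos hg, zero_add]
      refine ⟨Subtype.ext ?_, rfl, rfl⟩
      rw [Nonneg.coe_add, coe_ofPos_of_nonneg hgx, coe_ofNeg_of_nonpos hg, neg_add_cancel_left]
    · right
      rw [ofPos_of_nonpos hg, ofPos_of_nonpos hgx]
      refine ⟨rfl, Subtype.ext ?_, rfl, rfl⟩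
      rw [Nonneg.coe_add, coe_ofNeg_of_nonpos hg, coe_ofNeg_of_nonpos hgx]
      abel

theorem ofNeg_add_climb (x : PosCone Γ) (g : Γ) :
    ofNeg (g + x) + x = ofNeg g + climb x g := by
  rcases climb_cases x g with ⟨h1, h2, -⟩ | ⟨h1, h2, -⟩
  · rw [h2, zero_add, ← h1]
  · rw [h1, add_zero, ← h2]

/-- The cocycle identity behind `U_{x+y} = U_x U_y`. -/
theorem climb_add (x y : PosCone Γ) (g : Γ) :
    climb (x + y) g = climb x (g + y) + climb y g := by
  rcases le_total 0 g with hg | hg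
  · rw [climb_of_nonneg _ hg, climb_of_nonneg _ hg, climb_of_nonneg _ (add_nonneg hg y.2)]
  · rw [climb_of_nonpos _ hg, climb_of_nonpos y hg, Nonneg.coe_add, add_comm (x : Γ), ← add_assoc]
    rcases le_total 0 (g + y) with hgy | hgy
    · rw [climb_of_nonneg _ hgy]
      apply Subtype.ext
      rw [Nonneg.coe_add, coe_ofPos_of_nonneg hgy, coe_ofPos_of_nonneg (add_nonneg hgy x.2),
        add_comm]
    · rw [climb_of_nonpos _ hgy, ofPos_of_nonpos hgy, add_zero]

end PosCone

/-! ### The representation relations, level by level. -/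

namespace EndoAction

open PosCone

variable {Γ : Type*} [AddCommGroup Γ] [LinearOrder Γ] [IsOrderedAddMonoid Γ]
  {A : Type*} [CStarAlgebra A] (α : EndoAction Γ A)

theorem level_mul_left (g : Γ) (a b c : A) :
    star (α.endo (ofNeg g) c * a) * (α.endo (ofNeg g) 1 * b) =
      star a * (α.endo (ofNeg g) 1 * (α.endo (ofNeg g) (star c) * b)) := by
  rw [star_mul, ← map_star, ← mul_assoc (α.endo (ofNeg g) 1), α.endo_one_mul_endo, mul_assoc,
    ← mul_assoc (α.endo (ofNeg g) (star c)), α.endo_mul_endo_one]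

theorem level_intertwine (x : PosCone Γ) (g : Γ) (b c : A) :
    α.endo (climb x g) (α.endo (ofNeg g) 1 * (α.endo (ofNeg g) c * b)) =
      α.endo (ofNeg (g + x)) (α.endo x c) * α.endo (climb x g) (α.endo (ofNeg g) 1 * b) := by
  rw [← α.endo_add_apply, ofNeg_add_climb, add_comm, α.endo_add_apply, ← map_mul, ← mul_assoc,
    ← mul_assoc, α.endo_one_mul_endo, α.endo_mul_endo_one]

/-- The projection inserted by the second shift is redundant: above zero it is `1`, and below zero
it dominates the projection already present. -/
theorem level_shift_add (x y : PosCone Γ) (g : Γ) (b : A) :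
    α.endo (climb (x + y) g) (α.endo (ofNeg g) 1 * b) =
      α.endo (climb x (g + y)) (α.endo (ofNeg (g + y)) 1 *
        α.endo (climb y g) (α.endo (ofNeg g) 1 * b)) := by
  rw [climb_add, α.endo_add_apply]
  congr 1
  rcases climb_cases y g with ⟨h1, h2, h3⟩ | ⟨h1, h2, h3, h4⟩
  · rw [h2, α.endo_zero_apply, one_mul]
  · rw [h1, α.endo_zero_apply, h2, ← mul_assoc, α.endo_one_mul_endo_add_one]

end EndoAction

namespace IsCompleteTransferAction

open PosCone

variable {Γ : Type*} [AddCommGroup Γ] [LinearOrder Γ] [IsOrderedAddMonoid Γ]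
  {A : Type*} [CStarAlgebra A] [PartialOrder A] [StarOrderedRing A]
  {α : EndoAction Γ A} {L : PosCone Γ → (A →L[ℂ] A)}

/-- Adjointness of `U_x` and `L_t`, `t = climb x g`: above zero it is the transfer identity, below
zero only the cutting projections have to be compared. -/
theorem level_shift_left (h : IsCompleteTransferAction α L) (x : PosCone Γ) (g : Γ) (a b : A) :
    L (ofPos (g + x)) (star (α.endo (climb x g) (α.endo (ofNeg g) 1 * a)) *
      (α.endo (ofNeg (g + x)) 1 * b)) =
      L (ofPos g) (star a * (α.endo (ofNeg g) 1 * L (climb x g) b)) := by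
  have he := (α.isStarProjection_endo_one (ofNeg g)).isSelfAdjoint.star_eq
  rcases climb_cases x g with ⟨-, h2, h3⟩ | ⟨h1, h2, h3, h4⟩
  · rw [h2, h3, add_comm, h.map_add_apply, α.endo_zero_apply, one_mul, ← map_star, h.transfer,
      star_mul, he, mul_assoc]
  · rw [h1, h3, h4, h.map_zero, h.map_zero, h.map_zero, α.endo_zero_apply, star_mul, he, h2,
      mul_assoc, ← mul_assoc _ _ b, α.endo_add_one_mul_endo_one]

/-- This encodes `U_x* π(c) U_x = π(L_x(c))`. Completeness is applied to `α_m ∘ L_m`, `m = ofNeg g`,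
above zero and to `α_x ∘ L_x` below. -/
theorem level_conj_shift (h : IsCompleteTransferAction α L) (x : PosCone Γ) (g : Γ) (b c : A) :
    α.endo (ofNeg g) 1 * L (climb x g) (α.endo (ofNeg (g + x)) c *
      α.endo (climb x g) (α.endo (ofNeg g) 1 * b)) =
      α.endo (ofNeg g) 1 * (α.endo (ofNeg g) (L x c) * b) := by
  rcases climb_cases x g with ⟨h1, h2, h3⟩ | ⟨h1, h2, h3, h4⟩
  · rw [h.transfer_right, h2, α.endo_zero_apply]
    conv_rhs => rw [h1, add_comm, h.map_add_apply, h.complete]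
    have := (α.isStarProjection_endo_one (ofNeg g)).isIdempotentElem.eq
    simp only [← mul_assoc, this]
  · rw [h1, h.map_zero, α.endo_zero_apply, h2, α.endo_add_apply _ _ (L x c), h.complete, map_mul,
      map_mul, ← α.endo_add_apply]
    have := (α.isStarProjection_endo_one (ofNeg (g + x) + x)).isIdempotentElem.eq
    simp only [← mul_assoc, this]

/-- This encodes `U_x π(c) U_x* = π(α_x(c))`. Completeness produces `α_t(1)` on both sides of `b`,
with `t = climb x g`; above zero the left one is absorbed by `α_x(c)` and the right one by the
factor `L_t` of `L_{p+t}`, `p = ofPos g`, while below zero `t = 0`. -/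
theorem level_conj_shift_adjoint (h : IsCompleteTransferAction α L) (x : PosCone Γ) (g : Γ)
    (a b c : A) :
    L (ofPos (g + x)) (star a * (α.endo (ofNeg (g + x)) 1 *
      α.endo (climb x g) (α.endo (ofNeg g) 1 * (α.endo (ofNeg g) c * L (climb x g) b)))) =
    L (ofPos (g + x)) (star a * (α.endo (ofNeg (g + x)) 1 *
      (α.endo (ofNeg (g + x)) (α.endo x c) * b))) := by
  rw [← mul_assoc (α.endo (ofNeg g) 1), α.endo_one_mul_endo, map_mul (α.endo _), h.complete]
  rcases climb_cases x g with ⟨h1, h2, h3⟩ | ⟨h1, h2, h3, h4⟩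
  · rw [h2, α.endo_zero_apply, one_mul, one_mul, h3, add_comm, h.map_add_apply, h.map_add_apply,
      ← mul_assoc, ← mul_assoc, h.map_mul_endo_one, ← mul_assoc, mul_assoc (star a),
      α.endo_mul_endo_one, ← α.endo_add_apply, add_comm, ← h1, α.endo_zero_apply, mul_assoc]
  · rw [h1, α.endo_zero_apply, α.endo_zero_apply, one_mul, mul_one, ← α.endo_add_apply, ← h2]

end IsCompleteTransferAction

/-- The operator on finitely supported functions moving the entry `a` at `i` to the entry `T i a`
at `σ i`. -/
noncomputable def finsuppShift {I V : Type*} [AddCommGroup V] [Module ℂ V] (σ : I → I)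
    (T : I → V →ₗ[ℂ] V) : (I →₀ V) →ₗ[ℂ] (I →₀ V) :=
  Finsupp.lsum ℂ fun i => Finsupp.lsingle (σ i) ∘ₗ T i

theorem finsuppShift_single {I V : Type*} [AddCommGroup V] [Module ℂ V] (σ : I → I)
    (T : I → V →ₗ[ℂ] V) (i : I) (a : V) :
    finsuppShift σ T (Finsupp.single i a) = Finsupp.single (σ i) (T i a) := by
  simp [finsuppShift]

/-! ### The Fock-type space and its operators. -/

section FockIndex

open scoped ComplexOrder

variable {Γ : Type v} [AddCommGroup Γ] {A : Type u} [CStarAlgebra A] [PartialOrder A]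
  [StarOrderedRing A]

/-- The levels of the Fock-type space: a group element and a positive functional; the last factor
only raises the universe. -/
abbrev FockIndex (Γ : Type v) (A : Type u) [CStarAlgebra A] [PartialOrder A]
    [StarOrderedRing A] : Type (max u v w) :=
  Γ × (A →ₚ[ℂ] ℂ) × PUnit.{w + 1}

/-- The shift of the levels by a group element. -/
def FockIndex.shift (x : Γ) (i : FockIndex.{u, v, w} Γ A) : FockIndex.{u, v, w} Γ A :=
  (i.1 + x, i.2)

theorem FockIndex.exists_shift_eq (x : Γ) (j : FockIndex.{u, v, w} Γ A) :
    ∃ i : FockIndex.{u, v, w} Γ A, i.shift x = j :=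
  ⟨j.shift (-x), by simp [FockIndex.shift]⟩

theorem FockIndex.shift_injective (x : Γ) :
    Function.Injective (FockIndex.shift x : FockIndex.{u, v, w} Γ A → FockIndex.{u, v, w} Γ A) := by
  rintro ⟨g, f⟩ ⟨g', f'⟩ h
  simpa [FockIndex.shift] using h

end FockIndex

section Construction

open scoped ComplexOrder
open PosCone

variable {Γ : Type v} [AddCommGroup Γ] [LinearOrder Γ] [IsOrderedAddMonoid Γ]
  {A : Type u} [CStarAlgebra A] [PartialOrder A] [StarOrderedRing A]

/-- The sesquilinear form `(a, b) ↦ f (L_p (a⋆ α_m(1) b))` on the level `(p - m, f)`. -/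
noncomputable def fockForm (α : EndoAction Γ A) (L : PosCone Γ → (A →L[ℂ] A))
    (i : FockIndex.{u, v, w} Γ A) : A →ₗ⋆[ℂ] A →ₗ[ℂ] ℂ :=
  LinearMap.mk₂'ₛₗ (starRingEnd ℂ) (RingHom.id ℂ)
    (fun a b => i.2.1 (L (ofPos i.1) (star a * (α.endo (ofNeg i.1) 1 * b))))
    (fun a b c => by simp only [star_add, add_mul, map_add])
    (fun c a b => by simp only [star_smul, smul_mul_assoc, map_smul]; rfl)
    (fun a b c => by simp only [mul_add, map_add])
    (fun c a b => by simp only [mul_smul_comm, map_smul, RingHom.id_apply])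

theorem fockForm_apply (α : EndoAction Γ A) (L : PosCone Γ → (A →L[ℂ] A))
    (i : FockIndex.{u, v, w} Γ A) (a b : A) :
    fockForm α L i a b = i.2.1 (L (ofPos i.1) (star a * (α.endo (ofNeg i.1) 1 * b))) := rfl

/-- The formal representation of `A`. -/
noncomputable def fockRep (α : EndoAction Γ A) :
    A →ₗ[ℂ] ((FockIndex.{u, v, w} Γ A →₀ A) →ₗ[ℂ] (FockIndex.{u, v, w} Γ A →₀ A)) where
  toFun a := finsuppShift id fun i => LinearMap.mulLeft ℂ (α.endo (ofNeg i.1) a)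
  map_add' a b := by
    ext i c : 2
    simp [finsuppShift_single, add_mul]
  map_smul' c a := by
    ext i b : 2
    simp only [LinearMap.comp_apply, Finsupp.lsingle_apply, finsuppShift_single,
      LinearMap.smul_apply, RingHom.id_apply, LinearMap.mulLeft_apply, map_smul, smul_mul_assoc,
      Finsupp.smul_single]

/-- The formal shift operators. -/
noncomputable def fockShift (α : EndoAction Γ A) (x : PosCone Γ) :
    (FockIndex.{u, v, w} Γ A →₀ A) →ₗ[ℂ] (FockIndex.{u, v, w} Γ A →₀ A) :=
  finsuppShift (FockIndex.shift (x : Γ)) fun i =>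
    (α.endo (climb x i.1) : A →ₗ[ℂ] A) ∘ₗ LinearMap.mulLeft ℂ (α.endo (ofNeg i.1) 1)

/-- The formal adjoints of the shift operators. -/
noncomputable def fockCoshift (L : PosCone Γ → (A →L[ℂ] A)) (x : PosCone Γ) :
    (FockIndex.{u, v, w} Γ A →₀ A) →ₗ[ℂ] (FockIndex.{u, v, w} Γ A →₀ A) :=
  finsuppShift (FockIndex.shift (-(x : Γ))) fun i => (L (climb x (i.1 + -(x : Γ))) : A →ₗ[ℂ] A)

theorem fockRep_single (α : EndoAction Γ A) (a b : A) (i : FockIndex.{u, v, w} Γ A) :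
    fockRep α a (Finsupp.single i b) = Finsupp.single i (α.endo (ofNeg i.1) a * b) :=
  finsuppShift_single _ _ _ _

theorem fockShift_single (α : EndoAction Γ A) (x : PosCone Γ) (b : A)
    (i : FockIndex.{u, v, w} Γ A) :
    fockShift α x (Finsupp.single i b) =
      Finsupp.single (i.shift (x : Γ)) (α.endo (climb x i.1) (α.endo (ofNeg i.1) 1 * b)) :=
  finsuppShift_single _ _ _ _

theorem fockCoshift_single_shift (L : PosCone Γ → (A →L[ℂ] A)) (x : PosCone Γ) (b : A)
    (i : FockIndex.{u, v, w} Γ A) :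
    fockCoshift L x (Finsupp.single (i.shift (x : Γ)) b) =
      Finsupp.single i (L (climb x i.1) b) := by
  obtain ⟨g, f⟩ := i
  refine (finsuppShift_single _ _ _ _).trans ?_
  simp only [FockIndex.shift, add_neg_cancel_right]
  rfl

variable {α : EndoAction Γ A} {L : PosCone Γ → (A →L[ℂ] A)}

/-- The semi-inner product on the Fock-type space of a transfer action. -/
noncomputable abbrev IsTransferAction.fockCore (h : IsTransferAction α L) :
    PreInnerProductSpace.Core ℂ (FockIndex.{u, v, w} Γ A →₀ A) :=
  finsuppCore (fockForm α L)
    (fun i a b => by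
      rw [fockForm_apply, fockForm_apply, ← StarHomClass.map_star, ← h.map_star, star_mul, star_mul, star_star,
        (α.isStarProjection_endo_one _).isSelfAdjoint.star_eq, mul_assoc])
    (fun i a => by
      rw [fockForm_apply]
      refine i.2.1.map_nonneg (h.positive _ _ ?_)
      have he := α.isStarProjection_endo_one (ofNeg i.1)
      have := star_left_conjugate_nonneg he.nonneg a
      rwa [mul_assoc] at this)

/-- A complete transfer action gives rise to a fine representation. -/
theorem IsCompleteTransferAction.finelyRepresentable (h : IsCompleteTransferAction α L) :
    FinelyRepresentable.{u, v, max u v w} α := by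
  classical
  let c := IsTransferAction.fockCore.{u, v, w} h.toIsTransferAction
  let _ : SeminormedAddCommGroup (FockIndex.{u, v, w} Γ A →₀ A) :=
    InnerProductSpace.Core.toSeminormedAddCommGroup (c := c)
  let _ : InnerProductSpace ℂ (FockIndex.{u, v, w} Γ A →₀ A) := InnerProductSpace.ofCore c
  have hpre : IsPreFineRepresentation α L (fockRep.{u, v, w} α) (fockShift α) (fockCoshift L) :=
    { map_mul := fun a b ξ => by
        rw [← LinearMap.comp_apply]
        congr 1
        ext i d : 2
        simp only [LinearMap.comp_apply, Finsupp.lsingle_apply, fockRep_single, map_mul, mul_assoc]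
      inner_map_one := fun ξ η => by
        refine finsuppForm_congr_right (fockForm α L) (T := LinearMap.id) ξ (fun i b => ?_) η
        rw [LinearMap.id_apply, fockRep_single, finsuppForm_single_right, finsuppForm_single_right,
          fockForm_apply, fockForm_apply, ← mul_assoc (α.endo _ 1),
          (α.isStarProjection_endo_one _).isIdempotentElem.eq]
      inner_map_left := fun a ξ η => by
        refine finsuppForm_adjoint (fockForm α L) (fun i a j b => ?_) ξ η
        rw [fockRep_single, fockRep_single, finsuppForm_single_right, finsuppForm_single_right]
        by_cases hij : i = j
        · subst hij
          rw [Finsupp.single_eq_same, Finsupp.single_eq_same, fockForm_apply, fockForm_apply,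
            α.level_mul_left]
        · rw [Finsupp.single_eq_of_ne' hij, Finsupp.single_eq_of_ne' hij]
          simp
      faithful := fun a ha => by
        by_contra hne
        obtain ⟨f, hf⟩ := exists_positiveLinearMap_ne_zero (star_mul_self_nonneg a)
          (by rwa [Ne, CStarRing.star_mul_self_eq_zero_iff])
        apply hf
        -- On level zero the form is `f (a* b)`, so this matrix coefficient is `f (a* a)`.
        have := ha (Finsupp.single (0, f, PUnit.unit) a) (Finsupp.single (0, f, PUnit.unit) 1)
        change finsuppForm (fockForm α L) _ _ = 0 at this
        rw [fockRep_single, finsuppForm_single_right, Finsupp.single_eq_same, fockForm_apply,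
          ofPos_of_nonpos le_rfl, ofNeg_of_nonneg le_rfl, h.map_zero, α.endo_zero_apply,
          α.endo_zero_apply, one_mul, mul_one] at this
        exact this
      map_add := fun x y ξ => by
        rw [← LinearMap.comp_apply]
        congr 1
        ext i d : 2
        simp only [LinearMap.comp_apply, Finsupp.lsingle_apply, fockShift_single]
        rw [α.level_shift_add]
        congr 1
        exact Prod.ext (by simp only [FockIndex.shift, Nonneg.coe_add]; abel) rfl
      inner_u_left := fun x ξ η => by
        refine finsuppForm_adjoint (fockForm α L) (fun i a j b => ?_) ξ η
        -- Levels form a group orbit, so every level can be written as the target of a shift by `x`,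
        -- where the coshift has its explicit form.
        obtain ⟨j, rfl⟩ := j.exists_shift_eq (x : Γ)
        rw [fockShift_single, fockCoshift_single_shift, finsuppForm_single_right,
          finsuppForm_single_right]
        by_cases hij : i = j
        · subst hij
          rw [Finsupp.single_eq_same, Finsupp.single_eq_same, fockForm_apply, fockForm_apply]
          exact congrArg i.2.1 (h.level_shift_left x i.1 a b)
        · rw [Finsupp.single_eq_of_ne' hij,
            Finsupp.single_eq_of_ne' (fun e => hij (FockIndex.shift_injective _ e))]
          simp
      inner_conj_u := fun x a ξ η => by
        refine finsuppForm_congr_right (fockForm α L)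
          (S := fockCoshift L x ∘ₗ fockRep α a ∘ₗ fockShift α x) ξ (fun i b => ?_) η
        rw [LinearMap.comp_apply, LinearMap.comp_apply, fockShift_single, fockRep_single,
          fockRep_single, fockCoshift_single_shift, finsuppForm_single_right,
          finsuppForm_single_right, fockForm_apply, fockForm_apply, ← h.level_conj_shift]
        rfl
      inner_conj_v := fun x a ξ η => by
        refine finsuppForm_congr_right (fockForm α L)
          (S := fockShift α x ∘ₗ fockRep α a ∘ₗ fockCoshift L x) ξ (fun i b => ?_) η
        obtain ⟨i, rfl⟩ := i.exists_shift_eq (x : Γ)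
        rw [LinearMap.comp_apply, LinearMap.comp_apply, fockCoshift_single_shift, fockRep_single,
          fockShift_single, fockRep_single, finsuppForm_single_right, finsuppForm_single_right,
          fockForm_apply, fockForm_apply]
        exact congrArg i.2.1 (h.level_conj_shift_adjoint x i.1 _ b a)
      intertwine := fun x a ξ => by
        rw [← LinearMap.comp_apply, ← LinearMap.comp_apply]
        congr 1
        ext i d : 2
        simp only [LinearMap.comp_apply, Finsupp.lsingle_apply, fockShift_single, fockRep_single]
        rw [α.level_intertwine]
        rfl }
  exact ⟨_, _, _, inferInstance, _, _, hpre.isFineRepresentation⟩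

end Construction

theorem theorem3p2 {Γ : Type v} [AddCommGroup Γ] [LinearOrder Γ] [IsOrderedAddMonoid Γ]
    {A : Type u} [CStarAlgebra A] [PartialOrder A] [StarOrderedRing A] (α : EndoAction Γ A) :
    List.TFAE [
      FinelyRepresentable.{u, v, max u v w} α,
      ∃ L : PosCone Γ → (A →L[ℂ] A), IsCompleteTransferAction α L,
      (∃ L : PosCone Γ → (A →L[ℂ] A), IsNondegenerateTransferAction α L) ∧
        ∀ x : PosCone Γ, IsHereditarySubset (Set.range (α.endo x)),
      (∃ P : PosCone Γ → A, IsCentralProjectionFamily α P) ∧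
        ∀ x : PosCone Γ,
          Set.range (α.endo x) = Set.range fun a : A => α.endo x 1 * a * α.endo x 1] := by
  tfae_have 1 → 2 := by
    rintro ⟨H, _, _, _, π, U, h⟩
    exact h.exists_isCompleteTransferAction
  tfae_have 2 → 1 := fun ⟨_, h⟩ => IsCompleteTransferAction.finelyRepresentable.{u, v, w} h
  tfae_have 2 → 3 := fun ⟨L, h⟩ => ⟨⟨L, h.isNondegenerate⟩, h.isHereditarySubset_range⟩
  tfae_have 3 → 2 := fun ⟨⟨L, h⟩, hher⟩ => ⟨L, h.isComplete hher⟩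
  tfae_have 2 → 4 := fun ⟨L, h⟩ => ⟨⟨_, h.isCentralProjectionFamily⟩, h.range_eq⟩
  tfae_have 4 → 2 := fun ⟨⟨_, hP⟩, hr⟩ => hP.exists_isCompleteTransferAction hr
  tfae_finish
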